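/- Let $X$ be a nonempty finite set, let $d\ge 0$, and let $S=\{R_0,\dots,R_d\}$ be an association scheme on $X$ (not necessarily commutative). That is, $R_0,\dots,R_d$ are nonempty sets that partition $X\times X$, such that - $R_0=\{(y,y)\mid y\in X\}$; - for every $i$ there is an $i'$ with $R_{i'}=\{(y,z)\mid (z,y)\in R_i\}$; - for all $i,j,\ell$, the number $p_{ij}^{\ell}=|\{w\in X\mid (y,w)\in R_i,\ (w,z)\in R_j\}|$ is the same for all $(y,z)\in R_\ell$. Suppose that $S$ is quasi-thin, that is, all valencies $k_i:=p_{ii'}^{0}$ satisfy $k_i\le 2$. Let $F$ be a field (of any characteristic) and let $x\in X$. The Terwilliger algebra $\mathcal{T}_F(x)$ of $S$ with respect to $x$ is the unital $F$-subalgebra of the matrix algebra $M_X(F)$ generated by the adjacency matrices $A_i$ (with entry $1$ at $(y,z)\in R_i$ and $0$ elsewhere) and the dual idempotents $E_i^*(x)=\sum_{y:\,(x,y)\in R_i}E_{yy}$, for $0\le i\le d$, where $E_{yy}$ denotes the diagonal matrix unit at $y$. Then the Jacobson radical of $\mathcal{T}_F(x)$ is nilpotent, and its nilpotency index (the least $n$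 such that $\operatorname{rad}(\mathcal{T}_F(x))^n=0$) is at most $3$. -/

import Mathlib

/-- An association scheme of size `d` on a finite set `X`: a partition
`rel 0, …, rel d` of `X × X` into nonempty parts satisfying (S1), (S2), (S3).
No commutativity is assumed, and `X` is automatically nonempty, since `rel 0` is. -/
structure AssociationScheme (X : Type*) [Fintype X] (d : ℕ) where
  /-- the relations `R_0, …, R_d` -/
  rel : Fin (d + 1) → Set (X × X)
  rel_nonempty : ∀ i, (rel i).Nonempty
  rel_disjoint : ∀ i j, i ≠ j → Disjoint (rel i) (rel j)
  rel_cover : ⋃ i, rel i = Set.univ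
  /-- (S1) -/
  rel_zero : rel 0 = {p | p.1 = p.2}
  /-- (S2) -/
  exists_transpose : ∀ i, ∃ i', rel i' = {p | (p.2, p.1) ∈ rel i}
  /-- (S3) -/
  regular : ∀ i j l : Fin (d + 1), ∀ x y u v : X, (x, y) ∈ rel l → (u, v) ∈ rel l →
    {z : X | (x, z) ∈ rel i ∧ (z, y) ∈ rel j}.ncard =
      {w : X | (u, w) ∈ rel i ∧ (w, v) ∈ rel j}.ncard

namespace AssociationScheme

noncomputable section

/-- The (unique) index `i'` such that `R_{i'}` is the transpose of `R_i`. -/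
def transposeIdx {X : Type*} [Fintype X] {d : ℕ} (S : AssociationScheme X d)
    (i : Fin (d + 1)) : Fin (d + 1) :=
  (S.exists_transpose i).choose

/-- The intersection number `p_{ij}^l = |{z | (x, z) ∈ R_i, (z, y) ∈ R_j}|`, computed at some pair
`(x, y) ∈ R_l`; by (S3) the choice of the pair is irrelevant, see `intersectionNumber_eq`. -/
def intersectionNumber {X : Type*} [Fintype X] {d : ℕ} (S : AssociationScheme X d)
    (i j l : Fin (d + 1)) : ℕ :=
  {z : X | ((S.rel_nonempty l).some.1, z) ∈ S.rel i ∧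
    (z, (S.rel_nonempty l).some.2) ∈ S.rel j}.ncard

/-- The valency `k_i = p_{i i'}^0`. -/
def valency {X : Type*} [Fintype X] {d : ℕ} (S : AssociationScheme X d) (i : Fin (d + 1)) : ℕ :=
  S.intersectionNumber i (S.transposeIdx i) 0

/-- A scheme is quasi-thin if all its valencies are at most `2`. -/
def IsQuasiThin {X : Type*} [Fintype X] {d : ℕ} (S : AssociationScheme X d) : Prop :=
  ∀ i, S.valency i ≤ 2

open Classical in
/-- The adjacency matrix `A_i` of the relation `R_i`. -/
def adjMatrix {X : Type*} [Fintype X] {d : ℕ} (S : AssociationScheme X d)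
    (R : Type*) [CommRing R] (i : Fin (d + 1)) : Matrix X X R :=
  Matrix.of fun y z => if (y, z) ∈ S.rel i then 1 else 0

open Classical in
/-- The dual idempotent `E_i^*(x)`: the sum of the matrix units `E_{yy}` over `y ∈ x R_i`. -/
def dualIdempotent {X : Type*} [Fintype X] [DecidableEq X] {d : ℕ} (S : AssociationScheme X d)
    (R : Type*) [CommRing R] (x : X) (i : Fin (d + 1)) : Matrix X X R :=
  ∑ y : X with (x, y) ∈ S.rel i, Matrix.single y y 1

/-- The Terwilliger `R`-algebra of `S` with respect to the vertex `x`. -/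
def terwilligerAlgebra {X : Type*} [Fintype X] [DecidableEq X] {d : ℕ}
    (S : AssociationScheme X d) (R : Type*) [CommRing R] (x : X) :
    Subalgebra R (Matrix X X R) :=
  Algebra.adjoin R (Set.range (S.adjMatrix R) ∪ Set.range (S.dualIdempotent R x))

end

theorem rel_transposeIdx {X : Type*} [Fintype X] {d : ℕ} (S : AssociationScheme X d)
    (i : Fin (d + 1)) : S.rel (S.transposeIdx i) = {p | (p.2, p.1) ∈ S.rel i} :=
  (S.exists_transpose i).choose_spec

theorem intersectionNumber_eq {X : Type*} [Fintype X] {d : ℕ} (S : AssociationScheme X d)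
    (i j l : Fin (d + 1)) (x y : X) (h : (x, y) ∈ S.rel l) :
    S.intersectionNumber i j l = {z : X | (x, z) ∈ S.rel i ∧ (z, y) ∈ S.rel j}.ncard :=
  S.regular i j l _ _ x y (S.rel_nonempty l).some_mem h

theorem valency_eq {X : Type*} [Fintype X] {d : ℕ} (S : AssociationScheme X d)
    (i : Fin (d + 1)) (x : X) : S.valency i = {y : X | (x, y) ∈ S.rel i}.ncard := by
  rw [valency, S.intersectionNumber_eq i _ 0 x x (by rw [S.rel_zero]; rfl)]
  simp [rel_transposeIdx]

end AssociationScheme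

namespace AssociationScheme

variable {X : Type*} [Fintype X] {d : ℕ} (S : AssociationScheme X d)

/-! Each block `x R_i` has at most two points; let `τ` interchange the points of every two-point
block and fix the others. Regularity forces `τ` to preserve every relation (`swap_mem_rel`), so
every element of the algebra is `τ`-invariant, and its restriction to a pair of two-point blocks has
the form `(α β; β α)`. For a radical element, nilpotency gives two facts in any characteristic: the
entries of each block sum to `0` (`sum_block_eq_zero`), and `α = β`, so all entries of a block are
equal (`apply_eq_of_colour_eq`). In a product `a * b * c` of radical elements the outer factors are
thus constant on blocks, and only the block sums of `b` remain; these vanish. -/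

theorem exists_rel (y z : X) : ∃ i, (y, z) ∈ S.rel i := by
  have h : (y, z) ∈ ⋃ i, S.rel i := by rw [S.rel_cover]; trivial
  simpa using h

theorem rel_unique {y z : X} {i j : Fin (d + 1)} (hi : (y, z) ∈ S.rel i)
    (hj : (y, z) ∈ S.rel j) : i = j := by
  by_contra h
  exact Set.disjoint_left.1 (S.rel_disjoint i j h) hi hj

/-- The index of the relation containing `(x, y)`. -/
noncomputable def colour (x y : X) : Fin (d + 1) := (S.exists_rel x y).choose

theorem mem_rel_iff {x y : X} {i : Fin (d + 1)} : (x, y) ∈ S.rel i ↔ S.colour x y = i :=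
  ⟨fun h => S.rel_unique (S.exists_rel x y).choose_spec h,
    fun h => h ▸ (S.exists_rel x y).choose_spec⟩

theorem mem_rel_transposeIdx {i : Fin (d + 1)} {y z : X} :
    (y, z) ∈ S.rel (S.transposeIdx i) ↔ (z, y) ∈ S.rel i := by
  rw [rel_transposeIdx]; rfl

theorem exists_swap (hS : S.IsQuasiThin) (x : X) :
    ∃ τ : Equiv.Perm X, (∀ y, τ (τ y) = y) ∧
      ∀ y w, S.colour x w = S.colour x y ↔ w = y ∨ w = τ y := by
  have key : ∀ y, ∃ y', ∀ w, S.colour x w = S.colour x y ↔ w = y ∨ w = y' := by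
    intro y
    have hc : {w | S.colour x w = S.colour x y}.ncard ≤ 2 := by
      have := hS (S.colour x y)
      rw [S.valency_eq _ x] at this
      simpa only [mem_rel_iff] using this
    by_cases h : ∃ y', y' ≠ y ∧ S.colour x y' = S.colour x y
    · obtain ⟨y', hne, hy'⟩ := h
      have hsub : ({y, y'} : Set X) ⊆ {w | S.colour x w = S.colour x y} := by
        rintro w (rfl | rfl)
        · rfl
        · exact hy'
      have heq := Set.eq_of_subset_of_ncard_le hsub
        (by rwa [Set.ncard_pair hne.symm]) (Set.toFinite _)
      exact ⟨y', fun w => by simpa using (Set.ext_iff.1 heq w).symm⟩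
    · push Not at h
      refine ⟨y, fun w => ⟨fun hw => ?_, ?_⟩⟩
      · by_contra hne
        exact h w (by tauto) hw
      · rintro (rfl | rfl) <;> rfl
  choose τ hτ using key
  have hinv : Function.Involutive τ := by
    intro y
    have h1 : S.colour x (τ y) = S.colour x y := (hτ y _).2 (Or.inr rfl)
    rcases (hτ (τ y) y).1 h1.symm with h | h
    · rw [← h, ← h]
    · exact h.symm
  exact ⟨hinv.toPerm τ, hinv, hτ⟩

/-- A permutation of `X` interchanging the points of each two-point set `x R_i`. -/
noncomputable def swap (hS : S.IsQuasiThin) (x : X) : Equiv.Perm X :=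
  (S.exists_swap hS x).choose

/-! ### Invariance of the Terwilliger algebra under the swap -/

section swap

variable (hS : S.IsQuasiThin) (x : X)

theorem swap_swap (y : X) : S.swap hS x (S.swap hS x y) = y :=
  (S.exists_swap hS x).choose_spec.1 y

theorem colour_eq_iff (y w : X) :
    S.colour x w = S.colour x y ↔ w = y ∨ w = S.swap hS x y :=
  (S.exists_swap hS x).choose_spec.2 y w

theorem colour_swap (y : X) : S.colour x (S.swap hS x y) = S.colour x y :=
  (S.colour_eq_iff hS x y _).2 (Or.inr rfl)

open Classical in
theorem sum_colour_eq {M : Type*} [AddCommMonoid M] (z : X) (f : X → M) :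
    ∑ w with S.colour x w = S.colour x z, f w =
      if S.swap hS x z = z then f z else f z + f (S.swap hS x z) := by
  split_ifs with h
  · simp [S.colour_eq_iff hS x z, h, Finset.sum_filter]
  · have : ({w | S.colour x w = S.colour x z} : Finset X) = {z, S.swap hS x z} := by
      ext w; simp [S.colour_eq_iff hS x z]
    rw [this, Finset.sum_pair (Ne.symm h)]

open Classical in
theorem card_row_eq (j k : Fin (d + 1)) {y y' : X} (h : S.colour x y = S.colour x y') :
    (∑ z with S.colour x z = k, if (y, z) ∈ S.rel j then 1 else 0) =
      (∑ z with S.colour x z = k, if (y', z) ∈ S.rel j then 1 else 0 : ℕ) := by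
  -- Both sums count the paths from `x` through `z` with colours `k` and `j'`; their endpoints `y`,
  -- `y'` have the same colour.
  have hr := S.regular k (S.transposeIdx j) (S.colour x y') x y x y'
    (S.mem_rel_iff.2 h) (S.mem_rel_iff.2 rfl)
  simp only [mem_rel_transposeIdx, S.mem_rel_iff (x := x)] at hr
  simp only [Finset.sum_boole, Finset.filter_filter, Nat.cast_id]
  simpa only [Set.ncard_eq_toFinset_card', Set.toFinset_ofPred] using hr

/-- A 0/1 matrix of size 2 by 2 with equal row sums and equal column sums has equal diagonal entries
and equal off-diagonal entries. If a block is a single point, one of the two sum conditions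
suffices. -/
theorem swap_mem_rel {j : Fin (d + 1)} {y z : X} :
    (S.swap hS x y, S.swap hS x z) ∈ S.rel j ↔ (y, z) ∈ S.rel j := by
  classical
  have hrow := S.card_row_eq x j (S.colour x z) (S.colour_swap hS x y)
  have hcol := S.card_row_eq x (S.transposeIdx j) (S.colour x y) (S.colour_swap hS x z)
  simp only [S.sum_colour_eq hS x, mem_rel_transposeIdx] at hrow hcol
  by_cases hy : S.swap hS x y = y <;> by_cases hz : S.swap hS x z = z <;>
    simp only [hy, hz, if_true, if_false] at hrow hcol ⊢ <;> split_ifs at hrow hcol <;> simp_all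

variable [DecidableEq X] (R : Type*)

open Classical in
theorem dualIdempotent_eq_diagonal [CommRing R] (i : Fin (d + 1)) :
    S.dualIdempotent R x i = Matrix.diagonal fun y => if S.colour x y = i then 1 else 0 := by
  ext y z
  simp only [dualIdempotent, Matrix.sum_apply, Matrix.single_apply, Matrix.diagonal_apply,
    mem_rel_iff, Finset.sum_filter]
  rw [Finset.sum_eq_single y] <;> aesop

variable {R}

theorem adjMatrix_mem [CommRing R] (i : Fin (d + 1)) :
    S.adjMatrix R i ∈ S.terwilligerAlgebra R x :=
  Algebra.subset_adjoin (Or.inl ⟨i, rfl⟩)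

theorem dualIdempotent_mem [CommRing R] (i : Fin (d + 1)) :
    S.dualIdempotent R x i ∈ S.terwilligerAlgebra R x :=
  Algebra.subset_adjoin (Or.inr ⟨i, rfl⟩)

theorem apply_swap [CommRing R] {a : Matrix X X R} (ha : a ∈ S.terwilligerAlgebra R x)
    (y z : X) : a (S.swap hS x y) (S.swap hS x z) = a y z := by
  suffices h : a.submatrix (S.swap hS x) (S.swap hS x) = a from congrFun (congrFun h y) z
  induction ha using Algebra.adjoin_induction with
  | mem a ha =>
    rcases ha with ⟨i, rfl⟩ | ⟨i, rfl⟩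
    · ext y z
      classical exact if_congr (S.swap_mem_rel hS x) rfl rfl
    · ext y z; simp [dualIdempotent_eq_diagonal, Matrix.diagonal_apply, colour_swap]
  | algebraMap r => ext y z; simp [Matrix.algebraMap_matrix_apply]
  | add a b _ _ ha hb => rw [Matrix.submatrix_add, Pi.add_apply, Pi.add_apply, ha, hb]
  | mul a b _ _ ha hb =>
    rw [← Matrix.submatrix_mul_equiv a b _ (S.swap hS x), ha, hb]

theorem transpose_mem [CommRing R] {a : Matrix X X R} (ha : a ∈ S.terwilligerAlgebra R x) :
    a.transpose ∈ S.terwilligerAlgebra R x := by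
  induction ha using Algebra.adjoin_induction with
  | mem a ha =>
    rcases ha with ⟨i, rfl⟩ | ⟨i, rfl⟩
    · convert S.adjMatrix_mem x (S.transposeIdx i) using 1
      ext y z
      classical exact if_congr S.mem_rel_transposeIdx.symm rfl rfl
    · rw [dualIdempotent_eq_diagonal, Matrix.diagonal_transpose, ← dualIdempotent_eq_diagonal]
      exact S.dualIdempotent_mem x i
  | algebraMap r =>
    rw [Matrix.algebraMap_eq_diagonal, Matrix.diagonal_transpose, ← Matrix.algebraMap_eq_diagonal]
    exact Subalgebra.algebraMap_mem _ r
  | add a b _ _ ha hb => rw [Matrix.transpose_add]; exact add_mem ha hb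
  | mul a b _ _ ha hb => rw [Matrix.transpose_mul]; exact mul_mem hb ha

theorem allOnes_mem [CommRing R] :
    (Matrix.of fun _ _ => 1 : Matrix X X R) ∈ S.terwilligerAlgebra R x := by
  have : (Matrix.of fun _ _ => 1 : Matrix X X R) = ∑ i, S.adjMatrix R i := by
    ext y z
    simp [Matrix.sum_apply, adjMatrix, mem_rel_iff]
  rw [this]
  exact sum_mem fun i _ => S.adjMatrix_mem x i

end swap

/-! ### Entries of radical elements -/

section radical

variable [DecidableEq X] {R : Type*} [Field R] (x : X)

theorem isNilpotent_of_mem_jacobson {a : S.terwilligerAlgebra R x}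
    (ha : a ∈ Ring.jacobson (S.terwilligerAlgebra R x)) : IsNilpotent (a : Matrix X X R) := by
  have : IsArtinianRing (S.terwilligerAlgebra R x) := IsArtinianRing.of_finite R _
  obtain ⟨n, hn⟩ := IsSemiprimaryRing.isNilpotent (R := S.terwilligerAlgebra R x)
  refine ⟨n, ?_⟩
  have : a ^ n ∈ Ring.jacobson (S.terwilligerAlgebra R x) ^ n := Ideal.pow_mem_pow ha n
  rw [hn] at this
  rw [← Subalgebra.coe_pow, (Submodule.mem_bot _).1 this]
  rfl

-- With `J` the all-ones matrix, the sum is the trace of `E_k^* J E_i^* a`, which lies in the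
-- radical and is therefore nilpotent.
open Classical in
theorem sum_block_eq_zero {a : S.terwilligerAlgebra R x}
    (ha : a ∈ Ring.jacobson (S.terwilligerAlgebra R x)) (i k : Fin (d + 1)) :
    ∑ u with S.colour x u = i, ∑ v with S.colour x v = k, (a : Matrix X X R) u v = 0 := by
  let e : Fin (d + 1) → S.terwilligerAlgebra R x := fun i => ⟨_, S.dualIdempotent_mem x i⟩
  let o : S.terwilligerAlgebra R x := ⟨_, S.allOnes_mem x⟩
  have hmem : (e k * o * e i) * a ∈ Ring.jacobson (S.terwilligerAlgebra R x) :=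
    Ideal.mul_mem_left _ _ ha
  have htr := (Matrix.isNilpotent_trace_of_isNilpotent
    (S.isNilpotent_of_mem_jacobson x hmem)).eq_zero
  rw [← htr]
  simp only [e, o, Subalgebra.coe_mul, dualIdempotent_eq_diagonal, Matrix.trace, Matrix.diag,
    Matrix.mul_apply (M := _ * _ * _), Matrix.mul_diagonal, Matrix.diagonal_mul, Matrix.of_apply]
  rw [Finset.sum_comm, Finset.sum_filter]
  refine Finset.sum_congr rfl fun v _ => ?_
  split_ifs <;> simp [Finset.sum_filter]

theorem apply_eq_of_colour_eq (hS : S.IsQuasiThin) {a : S.terwilligerAlgebra R x}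
    (ha : a ∈ Ring.jacobson (S.terwilligerAlgebra R x)) (y : X) {u u' : X}
    (h : S.colour x u' = S.colour x u) :
    (a : Matrix X X R) y u' = (a : Matrix X X R) y u := by
  classical
  rcases (S.colour_eq_iff hS x u u').1 h with rfl | rfl
  · rfl
  have hsw := S.apply_swap hS x a.2
  set τ := S.swap hS x with hτ
  by_cases hy : τ y = y
  · rw [← hsw y u, hy]
  by_cases hu : τ u = u
  · rw [hu]
  let e : Fin (d + 1) → S.terwilligerAlgebra R x := fun i => ⟨_, S.dualIdempotent_mem x i⟩
  let b := e (S.colour x y) * a * e (S.colour x u)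
  -- The block `b` need not be square; `bᵀ * b` is, and still lies in the radical.
  let c : S.terwilligerAlgebra R x := ⟨_, S.transpose_mem x b.2⟩ * b
  have hb : ∀ v w, (b : Matrix X X R) v w =
      if S.colour x v = S.colour x y ∧ S.colour x w = S.colour x u
        then (a : Matrix X X R) v w else 0 := by
    intro v w
    simp only [b, e, Subalgebra.coe_mul, dualIdempotent_eq_diagonal, Matrix.mul_diagonal,
      Matrix.diagonal_mul]
    split_ifs <;> simp_all
  have hc : c ∈ Ring.jacobson (S.terwilligerAlgebra R x) :=
    Ideal.mul_mem_left _ _ (Ideal.mul_mem_right _ _ (Ideal.mul_mem_left _ _ ha))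
  obtain ⟨n, hn⟩ := S.isNilpotent_of_mem_jacobson x hc
  set α := (a : Matrix X X R) y u
  set β := (a : Matrix X X R) y (τ u)
  have h1 : (a : Matrix X X R) (τ y) (τ u) = α := hsw y u
  have h2 : (a : Matrix X X R) (τ y) u = β := by
    rw [← hsw (τ y) u, hτ, S.swap_swap]
  -- An eigenvector of `c` with eigenvalue `(α - β) ^ 2`, nonzero in every characteristic because `τ
  -- u ≠ u`. Nilpotency of `c` forces the eigenvalue to be `0`.
  let w : X → R := Pi.single u 1 - Pi.single (τ u) 1
  have hbw : (b : Matrix X X R).mulVec w = (α - β) • (Pi.single y 1 - Pi.single (τ y) 1) := by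
    ext v
    simp only [w, Matrix.mulVec_sub, Matrix.mulVec_single_one, Pi.sub_apply, Matrix.col_apply, hb,
      ← hτ, Pi.smul_apply, smul_eq_mul, Pi.single_apply,
      S.colour_eq_iff hS x y v, S.colour_eq_iff hS x u]
    by_cases hv : v = y
    · subst hv; simp [Ne.symm hy, α, β]
    · by_cases hv' : v = τ y
      · subst hv'; simp [hy, h1, h2]
      · simp [hv, hv']
  have hcw : (c : Matrix X X R).mulVec w = ((α - β) ^ 2) • w := by
    have hc' : (c : Matrix X X R) = (b : Matrix X X R).transpose * (b : Matrix X X R) := rfl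
    rw [hc', ← Matrix.mulVec_mulVec, hbw, Matrix.mulVec_smul]
    ext v
    simp only [w, Matrix.mulVec_sub, Matrix.mulVec_single_one, Pi.sub_apply, Matrix.col_apply, hb,
      ← hτ, Pi.smul_apply, smul_eq_mul, Pi.single_apply, Matrix.transpose_apply,
      S.colour_eq_iff hS x u v, S.colour_eq_iff hS x y]
    by_cases hv : v = u
    · subst hv; simp [Ne.symm hu, h2, α]; ring
    · by_cases hv' : v = τ u
      · subst hv'; simp [hu, h1, β]; ring
      · simp [hv, hv']
  have hpow : ∀ m : ℕ, ((c : Matrix X X R) ^ m).mulVec w = (((α - β) ^ 2) ^ m) • w := by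
    intro m
    induction m with
    | zero => simp
    | succ m ih =>
      rw [pow_succ, ← Matrix.mulVec_mulVec, hcw, Matrix.mulVec_smul, ih, smul_smul, ← pow_succ']
  have h0 := congrFun (hpow n) u
  rw [hn] at h0
  simp only [Matrix.zero_mulVec, w, Pi.zero_apply, Pi.smul_apply, Pi.sub_apply, smul_eq_mul,
    Pi.single_eq_same, Pi.single_eq_of_ne (Ne.symm hu), sub_zero, mul_one] at h0
  have := eq_zero_of_pow_eq_zero (eq_zero_of_pow_eq_zero h0.symm)
  exact (sub_eq_zero.1 this).symm

theorem apply_eq_of_colour_eq_left (hS : S.IsQuasiThin) {a : S.terwilligerAlgebra R x}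
    (ha : a ∈ Ring.jacobson (S.terwilligerAlgebra R x)) (z : X) {v v' : X}
    (h : S.colour x v' = S.colour x v) :
    (a : Matrix X X R) v' z = (a : Matrix X X R) v z := by
  rcases (S.colour_eq_iff hS x v v').1 h with rfl | rfl
  · rfl
  · rw [← S.apply_swap hS x a.2, S.swap_swap]
    exact S.apply_eq_of_colour_eq x hS ha v (S.colour_swap hS x z)

theorem mul_mul_eq_zero_of_mem_jacobson (hS : S.IsQuasiThin) {a b c : S.terwilligerAlgebra R x}
    (ha : a ∈ Ring.jacobson (S.terwilligerAlgebra R x))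
    (hb : b ∈ Ring.jacobson (S.terwilligerAlgebra R x))
    (hc : c ∈ Ring.jacobson (S.terwilligerAlgebra R x)) : a * b * c = 0 := by
  classical
  apply Subtype.ext
  ext y z
  -- Row `y` of `a` and column `z` of `c` depend only on colours, so they factor out of each block
  -- sum of `b`.
  obtain ⟨f, hf⟩ := (Function.factorsThrough_iff (f := S.colour x)
    fun u => (a : Matrix X X R) y u).1 fun _ _ h => S.apply_eq_of_colour_eq x hS ha y h
  obtain ⟨g, hg⟩ := (Function.factorsThrough_iff (f := S.colour x)
    fun v => (c : Matrix X X R) v z).1 fun _ _ h => S.apply_eq_of_colour_eq_left x hS hc z h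
  replace hf u : (a : Matrix X X R) y u = f (S.colour x u) := congrFun hf u
  replace hg v : (c : Matrix X X R) v z = g (S.colour x v) := congrFun hg v
  calc ((a * b * c : S.terwilligerAlgebra R x) : Matrix X X R) y z
      = ∑ v, ∑ u, f (S.colour x u) * (b : Matrix X X R) u v * g (S.colour x v) := by
        simp only [Subalgebra.coe_mul, Matrix.mul_apply, Finset.sum_mul, hf, hg]
    _ = ∑ i, ∑ k, f i * (∑ u with S.colour x u = i, ∑ v with S.colour x v = k,
          (b : Matrix X X R) u v) * g k := by
        rw [Finset.sum_comm, ← Finset.sum_fiberwise Finset.univ (S.colour x)]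
        refine Finset.sum_congr rfl fun i _ => ?_
        simp only [Finset.mul_sum, Finset.sum_mul]
        symm
        rw [Finset.sum_comm]
        refine Finset.sum_congr rfl fun u hu => ?_
        symm
        rw [← Finset.sum_fiberwise Finset.univ (S.colour x)]
        refine Finset.sum_congr rfl fun k _ => Finset.sum_congr rfl fun v hv => ?_
        rw [(Finset.mem_filter.1 hu).2, (Finset.mem_filter.1 hv).2]
    _ = 0 := by simp [S.sum_block_eq_zero x hb]

end radical

end AssociationScheme

theorem corollary2p14 {X : Type*} [Fintype X] [DecidableEq X] {d : ℕ}
    (S : AssociationScheme X d) (hS : S.IsQuasiThin) (R : Type*) [Field R] (x : X) :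
    IsNilpotent (Ring.jacobson (S.terwilligerAlgebra R x)) ∧
      nilpotencyClass (Ring.jacobson (S.terwilligerAlgebra R x)) ≤ 3 := by
  have h : Ring.jacobson (S.terwilligerAlgebra R x) ^ 3 = 0 := by
    rw [Submodule.pow_succ, Submodule.pow_succ, Submodule.pow_one, Ideal.zero_eq_bot, eq_bot_iff, Ideal.mul_le]
    intro r hr c hc
    refine Submodule.mul_induction_on hr (fun a ha b hb => ?_) fun p q hp hq => ?_
    · exact (Submodule.mem_bot _).2 (S.mul_mul_eq_zero_of_mem_jacobson x hS ha hb hc)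
    · rw [add_mul]
      exact add_mem hp hq
  exact ⟨⟨3, h⟩, Nat.sInf_le h⟩
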